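/- Let $p$ be a prime, let $L$ be a finite extension of $\mathbb{Q}_p$, and let $K$ be a complete non-archimedean extension field of $L$ which contains an algebraic closure $k$ of $L$. Let $D$ be a division algebra of degree $4$ over $L$ (that is, $D$ is a division ring with centre $L$ and $\dim_L D = 16$), and let $\mathbb{G}$ be the affine group scheme over $L$ with $\mathbb{G}(R) = (R \otimes_L D)^\times$ for every commutative $L$-algebra $R$; it is the connected $L$-form of $\mathrm{GL}_4$ with $\mathbb{G}(L) = D^\times$. Fix any isomorphism of $k$-algebras $k \otimes_L D \cong M_4(k)$; it identifies $\mathbb{G}$ with $\mathrm{GL}_4$ over $k$, and hence over $K$. A point $x \in \mathbb{G}(K)$ is called generic if the corresponding $L$-algebra homomorphism $\mathcal{O}(\mathbb{G}) \to K$ is injective. Let $X$ be the flag variety of $\mathrm{GL}_4$, which parametrizes the full flags $V_1 \subset V_2 \subset V_3$ in a $4$-dimensional space, with its natural action of $\mathrm{GL}_4$. Let $C \subset \mathbb{P}^3$ be the twisted cubic, defined by $x_0x_2 = x_1^2$, $x_1x_3 = x_2^2$, $x_0x_3 = x_1x_2$, and let $Y \subset X$ be the preimage of $C$ under either one of the two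 projections $X \to \mathbb{P}^3$: the one that sends a flag to its line $V_1$, or the one that sends a flag to its hyperplane $V_3$, regarded as the point $[a_0:a_1:a_2:a_3]$ when $V_3$ is given by $a_0x_0+a_1x_1+a_2x_2+a_3x_3=0$. Let $\mathbf{Y} \subset \mathbf{X}$ be the corresponding rigid analytic varieties over $K$; the points of $\mathbf{X}$ are the $\mathrm{Gal}(\overline{K}/K)$-orbits on $X(\overline{K})$, and $\mathbf{Y}$ consists of the orbits of the points of $Y(\overline{K})$. The group $\mathbb{G}(K)$, and so also its subgroup $D^\times$, acts on $\mathbf{X}$ through the identification of $\mathbb{G}$ with $\mathrm{GL}_4$ over $k$. Then, for every generic $x \in \mathbb{G}(K)$, the $D^\times$-orbit of $x\mathbf{Y}$ is regular in $\mathbf{X}$: for every $g \in D^\times$, $$ g x\mathbf{Y} \cap x\mathbf{Y} \neq \emptyset \quad \Longrightarrow \quad g x\mathbf{Y} = x\mathbf{Y}. $$ -/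

import Mathlib

open scoped TensorProduct

/-! ## Regular orbits -/

/-- Let a group `G` act on a set `X` (the action is given as a homomorphism `ρ` to the
permutation group of `X`) and let `Y ⊆ X`. The `G`-orbit of `Y` is *regular in `X`* if distinct
`G`-translates of `Y` are disjoint: `gY ∩ Y ≠ ∅` implies `gY = Y`, for all `g ∈ G`. -/
def IsRegularOrbit {G X : Type*} [Group G] (ρ : G →* Equiv.Perm X) (Y : Set X) : Prop :=
  ∀ g : G, ((ρ g '' Y) ∩ Y).Nonempty → ρ g '' Y = Y

/-! ## Full flags, the two projections to `ℙ³`, the twisted cubic -/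

/-- An `F`-point of the flag variety of `GL₄`: a chain `V₁ ⊂ V₂ ⊂ V₃` of subspaces of `F⁴`
with `dim Vᵢ = i`. -/
@[ext]
structure FullFlag (F : Type*) [Field F] where
  line : Submodule F (Fin 4 → F)
  plane : Submodule F (Fin 4 → F)
  hyperplane : Submodule F (Fin 4 → F)
  line_le : line ≤ plane
  plane_le : plane ≤ hyperplane
  finrank_line : Module.finrank F line = 1
  finrank_plane : Module.finrank F plane = 2
  finrank_hyperplane : Module.finrank F hyperplane = 3

/-- The linear automorphism `v ↦ g v` of `F⁴` given by an invertible matrix. -/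
noncomputable def glEquiv {F : Type*} [Field F] (g : GL (Fin 4) F) :
    (Fin 4 → F) ≃ₗ[F] (Fin 4 → F) :=
  LinearMap.GeneralLinearGroup.toLinearEquiv (Matrix.GeneralLinearGroup.toLin g)

theorem glEquiv_apply {F : Type*} [Field F] (g : GL (Fin 4) F) (v : Fin 4 → F) :
    glEquiv g v = Matrix.mulVec (g : Matrix (Fin 4) (Fin 4) F) v := rfl

theorem glEquiv_one {F : Type*} [Field F] :
    ((glEquiv (1 : GL (Fin 4) F)) : (Fin 4 → F) →ₗ[F] (Fin 4 → F)) = LinearMap.id := by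
  apply LinearMap.ext
  intro v
  simp [glEquiv_apply]

theorem glEquiv_mul {F : Type*} [Field F] (g h : GL (Fin 4) F) :
    ((glEquiv (g * h)) : (Fin 4 → F) →ₗ[F] (Fin 4 → F)) =
      (glEquiv g : (Fin 4 → F) →ₗ[F] (Fin 4 → F)) ∘ₗ
        (glEquiv h : (Fin 4 → F) →ₗ[F] (Fin 4 → F)) := by
  apply LinearMap.ext
  intro v
  simp [glEquiv_apply]

/-- `GL₄(F)` acts on full flags by `g • (V₁ ⊂ V₂ ⊂ V₃) = (gV₁ ⊂ gV₂ ⊂ gV₃)`. -/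
noncomputable instance FullFlag.instMulAction {F : Type*} [Field F] :
    MulAction (GL (Fin 4) F) (FullFlag F) where
  smul g f :=
    { line := f.line.map (glEquiv g : (Fin 4 → F) →ₗ[F] (Fin 4 → F))
      plane := f.plane.map (glEquiv g : (Fin 4 → F) →ₗ[F] (Fin 4 → F))
      hyperplane := f.hyperplane.map (glEquiv g : (Fin 4 → F) →ₗ[F] (Fin 4 → F))
      line_le := Submodule.map_mono f.line_le
      plane_le := Submodule.map_mono f.plane_le
      finrank_line := (LinearEquiv.finrank_map_eq (glEquiv g) f.line).trans f.finrank_line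
      finrank_plane := (LinearEquiv.finrank_map_eq (glEquiv g) f.plane).trans f.finrank_plane
      finrank_hyperplane :=
        (LinearEquiv.finrank_map_eq (glEquiv g) f.hyperplane).trans f.finrank_hyperplane }
  one_smul f := by
    apply FullFlag.ext
    · exact (congrArg (fun e => f.line.map e) glEquiv_one).trans (Submodule.map_id _)
    · exact (congrArg (fun e => f.plane.map e) glEquiv_one).trans (Submodule.map_id _)
    · exact (congrArg (fun e => f.hyperplane.map e) glEquiv_one).trans (Submodule.map_id _)
  mul_smul g h f := by
    apply FullFlag.ext
    · exact (congrArg (fun e => f.line.map e) (glEquiv_mul g h)).trans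
        (Submodule.map_comp _ _ _)
    · exact (congrArg (fun e => f.plane.map e) (glEquiv_mul g h)).trans
        (Submodule.map_comp _ _ _)
    · exact (congrArg (fun e => f.hyperplane.map e) (glEquiv_mul g h)).trans
        (Submodule.map_comp _ _ _)

/-- The twisted cubic in `ℙ³`: `x₀x₂ = x₁²`, `x₁x₃ = x₂²`, `x₀x₃ = x₁x₂`. -/
def twistedCubic (F : Type*) [Field F] : Set (Projectivization F (Fin 4 → F)) :=
  {P | ∀ v ∈ P.submodule,
    v 0 * v 2 = v 1 ^ 2 ∧ v 1 * v 3 = v 2 ^ 2 ∧ v 0 * v 3 = v 1 * v 2}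

/-- The first projection from the flag variety to `ℙ³`: a flag is sent to its line. -/
noncomputable def FullFlag.toPoint {F : Type*} [Field F] (f : FullFlag F) :
    Projectivization F (Fin 4 → F) :=
  Projectivization.mk'' f.line f.finrank_line

/-- The coefficient vectors of the linear forms `a₀x₀ + a₁x₁ + a₂x₂ + a₃x₃` that vanish on a
subspace `W` of `F⁴`. -/
def formsVanishingOn {F : Type*} [Field F] (W : Submodule F (Fin 4 → F)) :
    Submodule F (Fin 4 → F) where
  carrier := {a | ∀ v ∈ W, a ⬝ᵥ v = 0}
  zero_mem' := fun v _ => zero_dotProduct v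
  add_mem' := fun {a b} ha hb v hv => by rw [add_dotProduct, ha v hv, hb v hv, add_zero]
  smul_mem' := fun c a ha v hv => by rw [smul_dotProduct, ha v hv, smul_zero]

theorem finrank_formsVanishingOn {F : Type*} [Field F] (W : Submodule F (Fin 4 → F)) :
    Module.finrank F W + Module.finrank F (formsVanishingOn W) = 4 := by
  have h := Subspace.finrank_add_finrank_dualAnnihilator_eq W
  have e : formsVanishingOn W =
      W.dualAnnihilator.comap (dotProductEquiv F (Fin 4)).toLinearMap := by
    ext a
    simp [formsVanishingOn, Submodule.mem_dualAnnihilator]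
  have e' : Module.finrank F (formsVanishingOn W) = Module.finrank F W.dualAnnihilator := by
    have h' := LinearEquiv.finrank_map_eq (dotProductEquiv F (Fin 4)).symm W.dualAnnihilator
    rw [e, ← h', Submodule.map_equiv_eq_comap_symm]
    rfl
  rw [e', h, Module.finrank_fin_fun]

/-- The second projection from the flag variety to `ℙ³`: a flag is sent to its hyperplane
`a₀x₀ + a₁x₁ + a₂x₂ + a₃x₃ = 0`, viewed as the point `[a₀ : a₁ : a₂ : a₃]`
of the dual projective space. -/
noncomputable def FullFlag.toDualPoint {F : Type*} [Field F] (f : FullFlag F) :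
    Projectivization F (Fin 4 → F) :=
  Projectivization.mk'' (formsVanishingOn f.hyperplane) (by
    have h := finrank_formsVanishingOn f.hyperplane
    rw [f.finrank_hyperplane] at h
    omega)

/-! ## The rigid analytic flag variety over `K`, as a set

The points of the rigid analytification of a `K`-scheme of finite type `X` are the closed points
of `X`, that is, the orbits of `Gal(K̄/K)` on `X(K̄)`. -/

/-- Two flags over `K̄` are conjugate if some `σ ∈ Gal(K̄/K)` carries one to the other. -/
def galoisConj (K : Type*) [Field K] : Setoid (FullFlag (AlgebraicClosure K)) where
  r f f' := ∃ σ : AlgebraicClosure K ≃ₐ[K] AlgebraicClosure K,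
    (∀ v, v ∈ f.line ↔ (fun i => σ (v i)) ∈ f'.line) ∧
    (∀ v, v ∈ f.plane ↔ (fun i => σ (v i)) ∈ f'.plane) ∧
    (∀ v, v ∈ f.hyperplane ↔ (fun i => σ (v i)) ∈ f'.hyperplane)
  iseqv :=
    { refl := fun f => ⟨AlgEquiv.refl, fun _ => Iff.rfl, fun _ => Iff.rfl, fun _ => Iff.rfl⟩
      symm := by
        rintro f f' ⟨σ, h1, h2, h3⟩
        refine ⟨σ.symm, fun v => ?_, fun v => ?_, fun v => ?_⟩
        · simp [h1]
        · simp [h2]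
        · simp [h3]
      trans := by
        rintro f f' f'' ⟨σ, h1, h2, h3⟩ ⟨τ, k1, k2, k3⟩
        exact ⟨σ.trans τ, fun v => (h1 v).trans (k1 _), fun v => (h2 v).trans (k2 _),
          fun v => (h3 v).trans (k3 _)⟩ }

/-- The set of points of the rigid analytic flag variety of `GL₄` over `K`. -/
def RigidFlagVariety (K : Type*) [Field K] : Type _ := Quotient (galoisConj K)

/-- The Zariski closed subset of the rigid analytic flag variety that is the preimage of the
twisted cubic under the first projection. -/
def rigidY (K : Type*) [Field K] : Set (RigidFlagVariety K) :=
  Quotient.mk (galoisConj K) '' {f | f.toPoint ∈ twistedCubic (AlgebraicClosure K)}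

/-- The Zariski closed subset of the rigid analytic flag variety that is the preimage of the
twisted cubic under the second projection. -/
def rigidYDual (K : Type*) [Field K] : Set (RigidFlagVariety K) :=
  Quotient.mk (galoisConj K) '' {f | f.toDualPoint ∈ twistedCubic (AlgebraicClosure K)}

theorem glEquiv_galois {K : Type*} [Field K] (g : GL (Fin 4) K)
    (σ : AlgebraicClosure K ≃ₐ[K] AlgebraicClosure K) (v : Fin 4 → AlgebraicClosure K) :
    (fun i => σ (glEquiv (Matrix.GeneralLinearGroup.map
        (algebraMap K (AlgebraicClosure K)) g) v i)) =
      glEquiv (Matrix.GeneralLinearGroup.map (algebraMap K (AlgebraicClosure K)) g)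
        (fun i => σ (v i)) := by
  funext i
  simp [glEquiv_apply, Matrix.mulVec, dotProduct, map_sum]

theorem mem_map_galois {K : Type*} [Field K] (g : GL (Fin 4) K)
    (σ : AlgebraicClosure K ≃ₐ[K] AlgebraicClosure K)
    (W W' : Submodule (AlgebraicClosure K) (Fin 4 → AlgebraicClosure K))
    (h : ∀ v, v ∈ W ↔ (fun i => σ (v i)) ∈ W') (v : Fin 4 → AlgebraicClosure K) :
    v ∈ W.map (glEquiv (Matrix.GeneralLinearGroup.map (algebraMap K (AlgebraicClosure K)) g) :
        (Fin 4 → AlgebraicClosure K) →ₗ[AlgebraicClosure K] (Fin 4 → AlgebraicClosure K)) ↔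
      (fun i => σ (v i)) ∈
        W'.map (glEquiv (Matrix.GeneralLinearGroup.map (algebraMap K (AlgebraicClosure K)) g) :
          (Fin 4 → AlgebraicClosure K) →ₗ[AlgebraicClosure K] (Fin 4 → AlgebraicClosure K)) := by
  obtain ⟨w, rfl⟩ := (glEquiv (Matrix.GeneralLinearGroup.map
    (algebraMap K (AlgebraicClosure K)) g)).surjective v
  rw [glEquiv_galois]
  have key : ∀ (e : (Fin 4 → AlgebraicClosure K) ≃ₗ[AlgebraicClosure K]
      (Fin 4 → AlgebraicClosure K)) (U : Submodule (AlgebraicClosure K) _) (u),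
      e u ∈ U.map (e : (Fin 4 → AlgebraicClosure K) →ₗ[AlgebraicClosure K] _) ↔ u ∈ U := by
    intro e U u
    simp
  exact (key _ _ _).trans ((h w).trans (key _ _ _).symm)

/-- `GL₄(K)` acts on the rigid analytic flag variety over `K`. -/
noncomputable instance RigidFlagVariety.instMulAction {K : Type*} [Field K] :
    MulAction (GL (Fin 4) K) (RigidFlagVariety K) where
  smul g := Quotient.map
    (fun f => Matrix.GeneralLinearGroup.map (algebraMap K (AlgebraicClosure K)) g • f) (by
      rintro f f' ⟨σ, h1, h2, h3⟩
      exact ⟨σ, mem_map_galois g σ _ _ h1, mem_map_galois g σ _ _ h2,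
        mem_map_galois g σ _ _ h3⟩)
  one_smul P := by
    induction P using Quotient.inductionOn with
    | h f => exact congrArg (Quotient.mk (galoisConj K)) (by
        show Matrix.GeneralLinearGroup.map (algebraMap K (AlgebraicClosure K)) 1 • f = f
        rw [map_one, one_smul])
  mul_smul g h P := by
    induction P using Quotient.inductionOn with
    | h f => exact congrArg (Quotient.mk (galoisConj K)) (by
        show Matrix.GeneralLinearGroup.map (algebraMap K (AlgebraicClosure K)) (g * h) • f =
          Matrix.GeneralLinearGroup.map (algebraMap K (AlgebraicClosure K)) g •
            Matrix.GeneralLinearGroup.map (algebraMap K (AlgebraicClosure K)) h • f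
        rw [map_mul, mul_smul])

/-! ## The form `𝔾` of `GL₄` attached to `D`

`𝔾` is the affine group scheme `R ↦ (R ⊗ D)ˣ` over `L`; in particular `𝔾(L) = Dˣ`. Its underlying
scheme is the open subset of the affine space of `D` on which the norm does not vanish. -/

section Form

variable (L : Type*) [Field L] (D : Type*) [Ring D] [Algebra L D] [FiniteDimensional L D]

/-- The norm form of `D`: the determinant of left multiplication by the generic element
`∑ Xᵢ bᵢ` of `D`, where `(bᵢ)` is an `L`-basis of `D`. -/
noncomputable def normForm : MvPolynomial (Fin (Module.finrank L D)) L :=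
  Matrix.det (∑ i, (MvPolynomial.X i : MvPolynomial (Fin (Module.finrank L D)) L) •
    (Algebra.leftMulMatrix (Module.finBasis L D) (Module.finBasis L D i)).map MvPolynomial.C)

/-- The coordinate ring `𝒪(𝔾)`. -/
abbrev CoordRing : Type _ := Localization.Away (normForm L D)

/-- The group `𝔾(R)` of `R`-points. -/
abbrev FormPoints (R : Type*) [CommRing R] [Algebra L R] : Type _ := (R ⊗[L] D)ˣ

variable {L D} {R : Type*} [CommRing R] [Algebra L R]

/-- The coordinates of an element of `R ⊗ D` in the chosen basis of `D`. -/
noncomputable def formCoords (u : R ⊗[L] D) : Fin (Module.finrank L D) → R :=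
  fun i => ((Module.finBasis L D).baseChange R).repr u i

theorem aeval_normForm (u : R ⊗[L] D) :
    MvPolynomial.aeval (formCoords u) (normForm L D) =
      (Algebra.leftMulMatrix ((Module.finBasis L D).baseChange R) u).det := by
  have hu : u = ∑ i, formCoords u i • ((Module.finBasis L D).baseChange R) i :=
    (((Module.finBasis L D).baseChange R).sum_repr u).symm
  conv_rhs => rw [hu]
  rw [normForm, AlgHom.map_det]
  congr 1
  rw [map_sum, map_sum]
  refine Finset.sum_congr rfl fun i _ => ?_
  ext a c
  have h1 : (Algebra.leftMulMatrix ((Module.finBasis L D).baseChange R)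
      (formCoords u i • (Module.finBasis L D).baseChange R i)) =
      formCoords u i • Algebra.leftMulMatrix ((Module.finBasis L D).baseChange R)
        ((Module.finBasis L D).baseChange R i) := map_smul _ _ _
  rw [h1]
  simp only [AlgHom.mapMatrix_apply, Matrix.map_apply, Matrix.smul_apply, smul_eq_mul, map_mul,
    MvPolynomial.aeval_X, MvPolynomial.aeval_C, Algebra.leftMulMatrix_eq_repr_mul,
    Module.Basis.baseChange_apply, Algebra.TensorProduct.tmul_mul_tmul,
    Module.Basis.baseChange_repr_tmul]
  rw [Algebra.smul_def]
  ring

theorem isUnit_aeval_normForm (u : FormPoints L D R) :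
    IsUnit (MvPolynomial.aeval (formCoords (u : R ⊗[L] D)) (normForm L D)) := by
  rw [aeval_normForm, ← Matrix.isUnit_iff_isUnit_det]
  exact u.isUnit.map (Algebra.leftMulMatrix ((Module.finBasis L D).baseChange R))

/-- The `L`-algebra homomorphism `𝒪(𝔾) → R`, `f ↦ f(x)`, given by an `R`-point `x` of `𝔾`. -/
noncomputable def evalAt (x : FormPoints L D R) : CoordRing L D →ₐ[L] R :=
  IsLocalization.liftAlgHom (M := Submonoid.powers (normForm L D))
    (f := MvPolynomial.aeval (formCoords (x : R ⊗[L] D))) (by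
      rintro ⟨_, n, rfl⟩
      rw [map_pow]
      exact (isUnit_aeval_normForm x).pow n)

/-- `x ∈ 𝔾(R)` is *generic* if the `L`-algebra homomorphism `x : 𝒪(𝔾) → R` is injective. -/
def IsGenericFormPoint (x : FormPoints L D R) : Prop := Function.Injective (evalAt x)

end Form

section Splitting

variable {L k : Type*} [Field L] [Field k] [Algebra L k] {D : Type*} [Ring D] [Algebra L D]

/-- The homomorphism `Dˣ = 𝔾(L) → 𝔾(K)`. -/
def unitsToFormPoints (L : Type*) [Field L] (D : Type*) [Ring D] [Algebra L D]
    (K : Type*) [Field K] [Algebra L K] : Dˣ →* FormPoints L D K :=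
  Units.map (Algebra.TensorProduct.includeRight : D →ₐ[L] K ⊗[L] D).toMonoidHom

variable (φ : k ⊗[L] D ≃ₐ[k] Matrix (Fin 4) (Fin 4) k)
  (K : Type*) [Field K] [Algebra L K] [Algebra k K] [IsScalarTower L k K]

/-- The base change `K ⊗ D → M₄(K)`, `c ⊗ d ↦ c • φ(1 ⊗ d)`, of an isomorphism
`φ : k ⊗ D ≃ M₄(k)`. -/
noncomputable def splittingMap : K ⊗[L] D →ₐ[K] Matrix (Fin 4) (Fin 4) K :=
  Algebra.TensorProduct.lift (Algebra.ofId K (Matrix (Fin 4) (Fin 4) K))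
    (((Algebra.algHom L k K).mapMatrix.comp (φ.toAlgHom.restrictScalars L)).comp
      (Algebra.TensorProduct.includeRight : D →ₐ[L] k ⊗[L] D))
    (fun c _ => Algebra.commutes c _)

/-- The action of `𝔾(K)` on the rigid analytic flag variety over `K`, through the
identification of `𝔾` with `GL₄` over `k` given by `φ`. -/
noncomputable def rigidAction : FormPoints L D K →* Equiv.Perm (RigidFlagVariety K) :=
  (MulAction.toPermHom (GL (Fin 4) K) (RigidFlagVariety K)).comp
    (Units.map (splittingMap φ K).toMonoidHom)

end Splitting

/-!
An element `g ∈ Dˣ` that lies in the centre `L` acts by a scalar matrix, hence trivially, and there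
is nothing to prove. For all other `g` the translates `gxY` and `xY` are disjoint, by a dimension
count. Let `A ∈ GL₄(k)` be the matrix of `g` and `X ∈ GL₄(K)` that of `x`. A common point gives
points `c`, `c'` of the twisted cubic over `K̄` with `A X c = λ X c'`, up to the action of
`Gal(K̄/K)`, which preserves the cubic. As `x` is generic and `k` is algebraic over `L`, the `16`
entries of `X` cannot all lie in an extension of `k` generated by `15` elements
(`IsGenericFormPoint.hasIndependentEntries`).

The relation reads `∑ⱼ (cⱼ A - λ c'ⱼ) Xⱼ = 0` in terms of the columns `Xⱼ`. If one coefficient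
`cⱼ A - λ c'ⱼ` is invertible, the entries of `X` lie in the extension of `k` generated by the
entries of the other three columns and at most `3` parameters for `c`, `c'`, `λ`: `15` elements in
total. If none is, then the quotients `λ c'ⱼ / cⱼ` with `cⱼ ≠ 0` are eigenvalues of `A`, so they lie
in `k`; then a single parameter describes `c` and `λ c'`, and some coefficient is a nonzero multiple
of a matrix `A - μ` over `k`. Its rank is at least `2`, because `D` is a division algebra of degree
`4` and `g` is noncentral (`two_le_rank_sub_scalar`), so again `1 + 14 = 15` elements suffice. Both
cases are contradictory (`HasIndependentEntries.mulVec_ne`).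

For the preimage of the cubic under the second projection, the same count applies to the inverse
transpose of `X`, whose entries are independent as well, and to the transpose of the matrix of
`g⁻¹`.
-/

/-! ### Matrices with independent entries and linear relations -/

section

open IntermediateField

/-- Every independent linear relation over `k(S)` between the entries of `y` saves one generator
in an extension of `k` containing them all. -/
theorem exists_finset_adjoin_of_linear_relations {k F ι : Type*} [Field k] [Field F] [Algebra k F]
    [Fintype ι] (S : Finset F) {r : ℕ} (y : ι → F) (a : Fin r → ι → adjoin k (S : Set F))
    (ha : LinearIndependent (adjoin k (S : Set F)) a) (h : ∀ m, ∑ i, a m i • y i = 0) :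
    ∃ T : Finset F, T.card + r ≤ S.card + Fintype.card ι ∧ ∀ i, y i ∈ adjoin k (T : Set F) := by
  classical
  let Φ := Fintype.linearCombination (adjoin k (S : Set F)) y
  have hker : r ≤ Module.finrank (adjoin k (S : Set F)) (LinearMap.ker Φ) := by
    have h1 : Submodule.span (adjoin k (S : Set F)) (Set.range a) ≤ LinearMap.ker Φ := by
      rw [Submodule.span_le]
      rintro _ ⟨m, rfl⟩
      simpa [Φ, Fintype.linearCombination_apply] using h m
    have h2 := finrank_span_eq_card ha
    have h3 := Submodule.finrank_mono h1
    simp only [Fintype.card_fin] at h2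
    omega
  have hsum := LinearMap.finrank_range_add_finrank_ker Φ
  rw [Module.finrank_fintype_fun_eq_card, Fintype.range_linearCombination] at hsum
  have : Module.Finite (adjoin k (S : Set F))
      (Submodule.span (adjoin k (S : Set F)) (Set.range y)) :=
    Module.Finite.span_of_finite (adjoin k (S : Set F)) (Set.finite_range y)
  obtain ⟨t, -, htc, hts, -⟩ := Submodule.exists_finset_span_eq_linearIndepOn
    (adjoin k (S : Set F)) (Set.range y)
  refine ⟨S ∪ t, ?_, fun i => ?_⟩
  · have := Finset.card_union_le S t
    omega
  · have hi : y i ∈ Submodule.span (adjoin k (S : Set F)) (t : Set F) := by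
      rw [hts]
      exact Submodule.subset_span ⟨i, rfl⟩
    have hST : (adjoin k (S : Set F)) ≤ adjoin k ((S ∪ t : Finset F) : Set F) :=
      adjoin.mono _ _ _ (by simp)
    generalize y i = z at hi
    induction hi using Submodule.span_induction with
    | mem x hx => exact subset_adjoin _ _ (by simp [Finset.mem_coe.mp hx])
    | zero => exact zero_mem _
    | add x y _ _ hx hy => exact add_mem hx hy
    | smul e x _ hx =>
      rw [Algebra.smul_def]
      exact mul_mem (hST e.2) hx

/-- The entries of a square matrix over an extension `F` of `k` are independent parameters over
`k`, in the sense that they do not all lie in an extension of `k` generated by fewer elements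
than the matrix has entries. -/
def HasIndependentEntries (k : Type*) {F n : Type*} [Field k] [Field F] [Algebra k F] [Fintype n]
    (Z : Matrix n n F) : Prop :=
  ∀ T : Finset F, (∀ i j, Z i j ∈ adjoin k (T : Set F)) → Fintype.card n ^ 2 ≤ T.card

theorem HasIndependentEntries.transpose {k F n : Type*} [Field k] [Field F] [Algebra k F]
    [Fintype n] {Z : Matrix n n F} (hZ : HasIndependentEntries k Z) :
    HasIndependentEntries k Z.transpose :=
  fun T hT => hZ T fun i j => hT j i

theorem inv_entry_mem {k F n : Type*} [Field k] [Field F] [Algebra k F] [Fintype n]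
    [DecidableEq n] (E : IntermediateField k F) {Z : Matrix n n F} (h : ∀ i j, Z i j ∈ E)
    (i j : n) : Z⁻¹ i j ∈ E := by
  let W : Matrix n n E := fun i j => ⟨Z i j, h i j⟩
  have hW : Z = (algebraMap E F).mapMatrix W := rfl
  rw [Matrix.inv_def, Matrix.smul_apply, Ring.inverse_eq_inv', hW, ← RingHom.map_det,
    ← RingHom.map_adjugate, smul_eq_mul]
  exact mul_mem (inv_mem (W.det).2) (W.adjugate i j).2

theorem HasIndependentEntries.inv {k F n : Type*} [Field k] [Field F] [Algebra k F] [Fintype n]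
    [DecidableEq n] {Z : Matrix n n F} (hZ : HasIndependentEntries k Z) (hu : IsUnit Z.det) :
    HasIndependentEntries k Z⁻¹ := by
  intro T hT
  refine hZ T fun i j => ?_
  have := inv_entry_mem _ hT i j
  rwa [Matrix.nonsing_inv_nonsing_inv _ hu] at this

/-- If `A Z c = Z d`, then the columns `Zⱼ` satisfy `∑ⱼ (cⱼ A - dⱼ) Zⱼ = 0`. Multiplied from the
left by row vectors `w`, this gives linear relations between the entries of `Z`, which are
independent as soon as their coefficients at a single column are. So `c` and `d` need at least that
many parameters. -/
theorem HasIndependentEntries.le_card_of_relation {k F : Type*} [Field k] [Field F] [Algebra k F]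
    {n : Type*} [Fintype n] [DecidableEq n]
    {Z : Matrix n n F} (hZ : HasIndependentEntries k Z) (A : Matrix n n k) (S : Finset F)
    {c d : n → F} (hc : ∀ j, c j ∈ adjoin k (S : Set F)) (hd : ∀ j, d j ∈ adjoin k (S : Set F))
    (hrel : ((algebraMap k F).mapMatrix A * Z).mulVec c = Z.mulVec d) {r : ℕ} (w : Fin r → n → k)
    (j : n) (hw : LinearIndependent F (fun m l => c j * algebraMap k F ((Matrix.vecMul (w m) A) l)
      - d j * algebraMap k F (w m l))) : r ≤ S.card := by
  set E := adjoin k (S : Set F) with hE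
  let a : Fin r → n × n → E := fun m p =>
    (⟨c p.2, hc p.2⟩ : E) * algebraMap k E ((Matrix.vecMul (w m) A) p.1)
      - (⟨d p.2, hd p.2⟩ : E) * algebraMap k E (w m p.1)
  have ha : LinearIndependent E a := by
    refine LinearIndependent.of_comp (LinearMap.funLeft E E (fun l : n => (l, j))) ?_
    rw [← linearIndependent_algebraMap_comp_iff (S := F)]
    exact hw
  obtain ⟨T, hT, hy⟩ := exists_finset_adjoin_of_linear_relations S
    (fun p : n × n => Z p.1 p.2) a ha (fun m => by
      have h := congrArg (fun u => (algebraMap k F ∘ w m) ⬝ᵥ u) hrel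
      simp only [← Matrix.mulVec_mulVec] at h
      rw [Matrix.dotProduct_mulVec] at h
      have hv : Matrix.vecMul (algebraMap k F ∘ w m) ((algebraMap k F).mapMatrix A) =
          algebraMap k F ∘ Matrix.vecMul (w m) A := by
        ext l
        simp [Matrix.vecMul, dotProduct]
      rw [hv] at h
      rw [← sub_eq_zero] at h
      rw [← h, Fintype.sum_prod_type]
      simp only [dotProduct, Matrix.mulVec, Function.comp, ← Finset.sum_sub_distrib,
        Finset.mul_sum]
      refine Finset.sum_congr rfl fun l _ => Finset.sum_congr rfl fun j' _ => ?_
      have hk : ∀ z : k, ((algebraMap k E z : E) : F) = algebraMap k F z := fun _ => rfl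
      simp only [a, Algebra.smul_def, map_sub, map_mul, IntermediateField.algebraMap_apply, hk]
      ring)
  have := hZ T fun i j => hy (i, j)
  rw [Fintype.card_prod, ← sq] at hT
  omega

/-! ### The cone over the twisted cubic -/

/-- The affine cone over the twisted cubic. -/
def IsTwistedCubicVector {F : Type*} [Field F] (v : Fin 4 → F) : Prop :=
  v 0 * v 2 = v 1 ^ 2 ∧ v 1 * v 3 = v 2 ^ 2 ∧ v 0 * v 3 = v 1 * v 2

/-- The point with parameter `t` of the standard parametrization of the twisted cubic. -/
def cubicPoint {F : Type*} [Field F] (t : F) : Fin 4 → F := fun j => t ^ (j : ℕ)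

theorem IsTwistedCubicVector.eq_smul {F : Type*} [Field F] {v : Fin 4 → F}
    (hv : IsTwistedCubicVector v) (h0 : v ≠ 0) :
    ∃ s : F, s ≠ 0 ∧ ((∃ t, v = s • cubicPoint t) ∨ v = s • Pi.single 3 1) := by
  obtain ⟨h1, h2, h3⟩ := hv
  by_cases hv0 : v 0 = 0
  · have hv1 : v 1 = 0 := by
      rw [hv0, zero_mul] at h1
      exact pow_eq_zero_iff two_ne_zero |>.1 h1.symm
    have hv2 : v 2 = 0 := by
      rw [hv1, zero_mul] at h2
      exact pow_eq_zero_iff two_ne_zero |>.1 h2.symm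
    have e : v = v 3 • Pi.single 3 1 := by
      funext j
      fin_cases j <;> simp [hv0, hv1, hv2]
    refine ⟨v 3, fun h => h0 ?_, Or.inr e⟩
    rw [e, h, zero_smul]
  · refine ⟨v 0, hv0, Or.inl ⟨v 1 / v 0, ?_⟩⟩
    have e2 : v 2 = v 1 ^ 2 / v 0 := by field_simp; linear_combination h1
    have e3 : v 3 = v 1 ^ 3 / v 0 ^ 2 := by
      have : v 3 = v 1 * v 2 / v 0 := by field_simp; linear_combination h3
      rw [this, e2]
      field_simp
    funext j
    fin_cases j
    · simp [cubicPoint]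
    · simp [cubicPoint]; field_simp
    · simp [cubicPoint, e2]; field_simp
    · simp [cubicPoint, e3]; field_simp

/-! ### The dimension count -/

theorem exists_linearIndependent_vecMul {k : Type*} [Field k] {n : Type*} [Fintype n]
    [DecidableEq n] (M : Matrix n n k) {r : ℕ} (hr : r ≤ M.rank) :
    ∃ w : Fin r → n → k, LinearIndependent k fun m => Matrix.vecMul (w m) M := by
  rw [← Matrix.rank_transpose, Matrix.rank] at hr
  obtain ⟨f, hf⟩ := exists_linearIndependent_of_le_finrank hr
  choose w hw using fun m => (f m).2
  refine ⟨w, ?_⟩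
  have h := hf.map' (LinearMap.range M.transpose.mulVecLin).subtype (Submodule.ker_subtype _)
  have e : (fun m => Matrix.vecMul (w m) M) =
      (LinearMap.range M.transpose.mulVecLin).subtype ∘ f := by
    funext m
    simp [← hw m]
  rw [e]
  exact h

section

variable {k F : Type*} [Field k] [Field F] [Algebra k F] {n : Type*} [Fintype n] [DecidableEq n]
  {Z : Matrix n n F} (hZ : HasIndependentEntries k Z) (A : Matrix n n k) (S : Finset F)
  {c d : n → F} (hc : ∀ j, c j ∈ adjoin k (S : Set F)) (hd : ∀ j, d j ∈ adjoin k (S : Set F))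
  (hrel : ((algebraMap k F).mapMatrix A * Z).mulVec c = Z.mulVec d) (j : n)

include hZ hc hd hrel

/-- An invertible coefficient `cⱼ A - dⱼ` expresses the column `Zⱼ` through the other columns. -/
theorem HasIndependentEntries.le_card_of_det_ne_zero
    (hdet : (c j • (algebraMap k F).mapMatrix A - Matrix.scalar n (d j)).det ≠ 0) :
    Fintype.card n ≤ S.card := by
  let e := (Fintype.equivFin n).symm
  refine hZ.le_card_of_relation A S hc hd hrel (fun m => Pi.single (e m) 1) j ?_
  have h := (Matrix.linearIndependent_rows_of_det_ne_zero hdet).comp e e.injective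
  refine (congrArg (fun f : Fin _ → n → F => LinearIndependent F f) ?_).mp h
  funext m l
  simp [Matrix.scalar_apply, Matrix.diagonal_apply, Pi.single_apply, eq_comm]

/-- The case in which the coefficient at the column `Zⱼ` is a nonzero multiple of `A - μ`. -/
theorem HasIndependentEntries.rank_le_card (μ : k) (hcj : c j ≠ 0)
    (hdj : d j = c j * algebraMap k F μ) : (A - Matrix.scalar n μ).rank ≤ S.card := by
  obtain ⟨w, hw⟩ := exists_linearIndependent_vecMul (A - Matrix.scalar n μ) le_rfl
  refine hZ.le_card_of_relation A S hc hd hrel w j ?_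
  have h1 := (linearIndependent_algebraMap_comp_iff (S := F)).2 hw
  refine (congrArg (fun f : Fin _ → n → F => LinearIndependent F f) ?_).mp
    (h1.units_smul fun _ => Units.mk0 (c j) hcj)
  funext m l
  change c j * algebraMap k F (Matrix.vecMul (w m) (A - Matrix.scalar n μ) l) = _
  simp [hdj, Matrix.vecMul_sub, Matrix.scalar_apply]
  ring

end

/-- A singular `x A - y` makes `y / x` an eigenvalue of `A`, hence an element of `k`. -/
theorem exists_algebraMap_eq_of_det_eq_zero {k F : Type*} [Field k] [IsAlgClosed k] [Field F]
    [Algebra k F] {n : Type*} [Fintype n] [DecidableEq n] {A : Matrix n n k} {x y : F} (hx : x ≠ 0)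
    (h : (x • (algebraMap k F).mapMatrix A - Matrix.scalar n y).det = 0) :
    ∃ μ : k, y = x * algebraMap k F μ := by
  have h1 : (Matrix.scalar n (y / x) - (algebraMap k F).mapMatrix A).det = 0 := by
    have : x • (algebraMap k F).mapMatrix A - Matrix.scalar n y =
        (-x) • (Matrix.scalar n (y / x) - (algebraMap k F).mapMatrix A) := by
      rw [smul_sub, neg_smul, neg_smul, sub_neg_eq_add, neg_add_eq_sub]
      congr 1
      ext i j
      simp [Matrix.scalar_apply, Matrix.diagonal_apply, mul_div_cancel₀ _ hx]
    rw [this, Matrix.det_smul] at h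
    exact (mul_eq_zero.1 h).resolve_left (pow_ne_zero _ (neg_ne_zero.2 hx))
  rw [← Matrix.eval_charpoly, RingHom.mapMatrix_apply, Matrix.charpoly_map,
    Polynomial.eval_map_algebraMap] at h1
  have hint : IsAlgebraic k (y / x) := ⟨A.charpoly, (Matrix.charpoly_monic A).ne_zero, h1⟩
  obtain ⟨μ, hμ⟩ := minpoly.mem_range_of_degree_eq_one k (y / x)
    (IsAlgClosed.degree_eq_one_of_irreducible k (minpoly.irreducible hint.isIntegral))
  exact ⟨μ, by rw [hμ, mul_div_cancel₀ _ hx]⟩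

/-- The dimension count at the heart of the argument: if the eigenspaces of `A` over `k` have
codimension at least `2` and `Z` has independent entries, then `A` carries no point of the
`Z`-translate of the twisted cubic to a point of that translate. -/
theorem HasIndependentEntries.mulVec_ne {k F : Type*} [Field k] [IsAlgClosed k] [Field F]
    [Algebra k F] {Z : Matrix (Fin 4) (Fin 4) F} (hZ : HasIndependentEntries k Z)
    {A : Matrix (Fin 4) (Fin 4) k} (hdet : A.det ≠ 0)
    (hA : ∀ μ : k, 2 ≤ (A - Matrix.scalar (Fin 4) μ).rank) {v v' : Fin 4 → F}
    (hv : IsTwistedCubicVector v) (hv0 : v ≠ 0) (hv' : IsTwistedCubicVector v') (hv0' : v' ≠ 0) :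
    ((algebraMap k F).mapMatrix A * Z).mulVec v ≠ Z.mulVec v' := by
  classical
  intro hrel
  obtain ⟨a, ha, hva⟩ := hv.eq_smul hv0
  obtain ⟨b, hb, hvb⟩ := hv'.eq_smul hv0'
  set l := b / a with hl
  have hl0 : l ≠ 0 := div_ne_zero hb ha
  have hbl : b = a * l := by rw [hl, mul_div_cancel₀ _ ha]
  have scale : ∀ c d : Fin 4 → F, v = a • c → v' = b • d →
      ((algebraMap k F).mapMatrix A * Z).mulVec c = Z.mulVec (l • d) := by
    intro c d hc hd
    rw [hc, hd, hbl, mul_smul, Matrix.mulVec_smul, Matrix.mulVec_smul] at hrel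
    exact smul_right_injective _ ha hrel
  have hdetF : ((algebraMap k F).mapMatrix A).det ≠ 0 := by
    rw [← RingHom.map_det]
    exact (map_ne_zero _).2 hdet
  -- At most three parameters occur, so no coefficient `cⱼ A - l dⱼ` can be invertible.
  have full : ∀ (S : Finset F) (c d : Fin 4 → F), S.card ≤ 3 → v = a • c → v' = b • d →
      (∀ j, c j ∈ adjoin k (S : Set F)) → (∀ j, (l • d) j ∈ adjoin k (S : Set F)) →
      ∀ j, (c j • (algebraMap k F).mapMatrix A - Matrix.scalar (Fin 4) (l * d j)).det = 0 := by
    intro S c d hS hc hd hcS hdS j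
    by_contra hne
    have := hZ.le_card_of_det_ne_zero A S hcS hdS (scale c d hc hd) j hne
    rw [Fintype.card_fin] at this
    omega
  -- When `c` and `l d` involve a single parameter, no coefficient can even be a nonzero multiple
  -- of some `A - μ`, because that has rank at least `2`.
  have single : ∀ (u : F) (c d : Fin 4 → F), v = a • c → v' = b • d →
      (∀ j, c j ∈ k⟮u⟯) → (∀ j, (l • d) j ∈ k⟮u⟯) →
      ∀ (j : Fin 4) (μ : k), c j ≠ 0 → l * d j ≠ c j * algebraMap k F μ := by
    intro u c d hc hd hcS hdS j μ hj hμ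
    have := hZ.rank_le_card A {u} (by simpa using hcS) (by simpa using hdS) (scale c d hc hd) j μ
      hj hμ
    have := hA μ
    rw [Finset.card_singleton] at *
    omega
  have gen : ∀ {S : Finset F} {u : F}, u ∈ S → u ∈ adjoin k (S : Set F) :=
    fun h => subset_adjoin _ _ (Finset.mem_coe.2 h)
  have pow_mem' : ∀ {E : IntermediateField k F} {u : F}, u ∈ E → ∀ j, cubicPoint u j ∈ E :=
    fun h j => pow_mem h _
  have e3_mem : ∀ (E : IntermediateField k F) (j : Fin 4), (Pi.single 3 1 : Fin 4 → F) j ∈ E := by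
    intro E j
    rw [Pi.single_apply]
    split_ifs
    exacts [one_mem _, zero_mem _]
  have hc0 : ∀ t : F, cubicPoint t 0 = 1 := fun t => pow_zero t
  rcases hva with ⟨t, hvt⟩ | hvt <;> rcases hvb with ⟨s, hvs⟩ | hvs
  -- The singular columns `0` and `1` force `l` and `l s / t` into `k`.
  · have hz := full {t, s, l} (cubicPoint t) (cubicPoint s) (Finset.card_le_three) hvt hvs
      (pow_mem' (gen (by simp)))
      (fun j => mul_mem (gen (by simp)) (pow_mem' (gen (by simp)) j))
    obtain ⟨μ, hμ⟩ := exists_algebraMap_eq_of_det_eq_zero (by simp [hc0]) (hz 0)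
    simp only [hc0, mul_one, one_mul] at hμ
    by_cases ht : t = 0
    · refine single s _ _ hvt hvs (pow_mem' (ht ▸ zero_mem _)) (fun j => ?_) 0 μ (by simp [hc0])
        (by simp [hc0, hμ])
      rw [hμ]
      exact mul_mem (IntermediateField.algebraMap_mem _ _) (pow_mem' (mem_adjoin_simple_self k s) j)
    · obtain ⟨ν, hν⟩ := exists_algebraMap_eq_of_det_eq_zero (x := cubicPoint t 1)
        (by simpa [cubicPoint] using ht) (hz 1)
      simp only [cubicPoint, Fin.val_one, pow_one] at hν
      have hs : s = t * algebraMap k F ν / algebraMap k F μ := by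
        rw [← hμ, eq_div_iff hl0, mul_comm, hν]
      have hs' : s ∈ k⟮t⟯ := hs ▸ div_mem
        (mul_mem (mem_adjoin_simple_self k t) (IntermediateField.algebraMap_mem _ _))
        (IntermediateField.algebraMap_mem _ _)
      refine single t _ _ hvt hvs (pow_mem' (mem_adjoin_simple_self k t)) (fun j => ?_) 0 μ
        (by simp [hc0]) (by simp [hc0, hμ])
      rw [hμ]
      exact mul_mem (IntermediateField.algebraMap_mem _ _) (pow_mem' hs' j)
  · have hz := full {t, l} (cubicPoint t) (Pi.single 3 1) (Finset.card_le_two.trans (by norm_num))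
      hvt hvs (pow_mem' (gen (by simp)))
      (fun j => mul_mem (gen (by simp)) (e3_mem _ j)) 0
    refine hdetF ?_
    simpa [hc0] using hz
  · have hz := full {s, l} (Pi.single 3 1) (cubicPoint s) (Finset.card_le_two.trans (by norm_num))
      hvt hvs (e3_mem _)
      (fun j => mul_mem (gen (by simp)) (pow_mem' (gen (by simp)) j)) 3
    by_cases hs : s = 0
    · refine hdetF ?_
      simpa [cubicPoint, hs] using hz
    obtain ⟨μ, hμ⟩ := exists_algebraMap_eq_of_det_eq_zero (by simp) hz
    have hl' : l = algebraMap k F μ / cubicPoint s 3 := by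
      rw [eq_div_iff (by simpa [cubicPoint] using hs), hμ]
      simp
    refine single s _ _ hvt hvs (e3_mem _) (fun j => ?_) 3 μ (by simp) hμ
    have hs' := pow_mem' (mem_adjoin_simple_self k s)
    rw [hl']
    exact mul_mem (div_mem (IntermediateField.algebraMap_mem _ _) (hs' 3)) (hs' j)
  · have hl' : ∀ j, (l • (Pi.single 3 1 : Fin 4 → F)) j ∈ k⟮l⟯ :=
      fun j => mul_mem (mem_adjoin_simple_self k l) (e3_mem _ j)
    have hz := full {l} (Pi.single 3 1) (Pi.single 3 1) (by simp) hvt hvs (e3_mem _)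
      (by simpa using hl') 3
    obtain ⟨μ, hμ⟩ := exists_algebraMap_eq_of_det_eq_zero (by simp) hz
    exact single l _ _ hvt hvs (e3_mem _) hl' 3 μ (by simp) hμ

end

/-! ### Eigenspaces of noncentral elements of a division algebra of degree `4` -/

theorem Matrix.mul_self_of_rank_le_one {k n : Type*} [Field k] [Fintype n] [DecidableEq n]
    {N : Matrix n n k} (h : N.rank ≤ 1) : N * N = N.trace • N := by
  rw [Matrix.rank, finrank_le_one_iff] at h
  obtain ⟨u, hu⟩ := h
  have hcol : ∀ j, ∃ c : k, ∀ i, N i j = (u : n → k) i * c := by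
    intro j
    obtain ⟨c, hc⟩ := hu ⟨_, LinearMap.mem_range_self N.mulVecLin (Pi.single j 1)⟩
    refine ⟨c, fun i => ?_⟩
    have := congrFun (congrArg Subtype.val hc) i
    simp at this
    rw [← this, mul_comm]
  choose c hc using hcol
  ext i j
  simp only [Matrix.mul_apply, Matrix.trace, Matrix.smul_apply, smul_eq_mul, Finset.sum_mul,
    Matrix.diag_apply]
  refine Finset.sum_congr rfl fun l _ => ?_
  simp only [hc]
  ring

theorem trace_mulLeft_matrix {k n : Type*} [Field k] [Fintype n] [DecidableEq n]
    (A : Matrix n n k) :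
    LinearMap.trace k (Matrix n n k) (LinearMap.mulLeft k A) = Fintype.card n * A.trace := by
  rw [LinearMap.trace_eq_matrix_trace k (Matrix.stdBasis k n n), Matrix.trace,
    Fintype.sum_prod_type, Finset.sum_comm]
  simp only [Matrix.diag_apply, LinearMap.toMatrix_apply, Matrix.stdBasis_eq_single]
  have : ∀ i j, ((Matrix.stdBasis k n n).repr (LinearMap.mulLeft k A (Matrix.single i j 1))) (i, j)
      = A i i := by
    intro i j
    rw [Matrix.stdBasis, Module.Basis.map_repr]
    simp [Matrix.mul_apply, Matrix.single]
  simp only [this]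
  simp [Matrix.trace]

section

variable {L k : Type*} [Field L] [Field k] [Algebra L k] {D : Type*}

/-- The trace of a split element of `D` is rational over the base: four times it is the trace of
left multiplication on `D`. -/
theorem exists_algebraMap_eq_trace [CharZero L] [Ring D] [Algebra L D] [FiniteDimensional L D]
    {n : Type*} [Fintype n] [DecidableEq n] [Nonempty n]
    (φ : k ⊗[L] D ≃ₐ[k] Matrix n n k) (d : D) :
    ∃ l : L, algebraMap L k l = (φ (1 ⊗ₜ d)).trace := by
  have h1 := LinearMap.trace_baseChange (LinearMap.mulLeft L d) k
  have h2 : (LinearMap.mulLeft L d).baseChange k = LinearMap.mulLeft k ((1 : k) ⊗ₜ[L] d) := by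
    ext; simp
  have h3 : φ.toLinearEquiv.conj (LinearMap.mulLeft k ((1 : k) ⊗ₜ[L] d)) =
      LinearMap.mulLeft k (φ (1 ⊗ₜ d)) := by
    ext x : 1
    simp [LinearEquiv.conj_apply]
  rw [h2, ← LinearMap.trace_conj' _ φ.toLinearEquiv, h3, trace_mulLeft_matrix] at h1
  have := charZero_of_injective_algebraMap (algebraMap L k).injective
  have h0 : (Fintype.card n : k) ≠ 0 := Nat.cast_ne_zero.2 Fintype.card_ne_zero
  refine ⟨LinearMap.trace L D (LinearMap.mulLeft L d) / Fintype.card n, ?_⟩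
  rw [map_div₀, ← h1, map_natCast, mul_div_cancel_left₀ _ h0]

/-- Eigenspaces of a noncentral element of a split division algebra of degree `4` have codimension
at least `2`. If `g - μ` had rank at most `1` and trace `τ`, the traceless part `g'` of `g` would
satisfy a quadratic equation with middle coefficient `τ / 2`; comparing traces puts `τ`, and then
`g - μ`, into `D`, where a nonzero element is invertible. -/
theorem two_le_rank_sub_scalar [CharZero L] [DivisionRing D] [Algebra L D] [FiniteDimensional L D]
    (φ : k ⊗[L] D ≃ₐ[k] Matrix (Fin 4) (Fin 4) k) {g : D} (hg : ∀ l : L, g ≠ algebraMap L D l)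
    (μ : k) : 2 ≤ (φ (1 ⊗ₜ g) - Matrix.scalar (Fin 4) μ).rank := by
  by_contra! hlt
  have := charZero_of_injective_algebraMap (algebraMap L k).injective
  let ψ : D →ₐ[L] Matrix (Fin 4) (Fin 4) k :=
    (φ.toAlgHom.restrictScalars L).comp Algebra.TensorProduct.includeRight
  have hψ : ∀ d, ψ d = φ (1 ⊗ₜ d) := fun _ => rfl
  have hψinj : Function.Injective ψ := ψ.toRingHom.injective
  have hψu : ∀ d, d ≠ 0 → (ψ d).rank = 4 := by
    intro d hd
    have := Matrix.rank_of_isUnit (ψ d) ((IsUnit.mk0 d hd).map ψ)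
    simpa using this
  have hscal : ∀ l : L, ψ (algebraMap L D l) = algebraMap L k l • 1 := by
    intro l
    rw [AlgHom.commutes, algebraMap_smul, Algebra.algebraMap_eq_smul_one]
  obtain ⟨N, hN⟩ : ∃ N, N = φ (1 ⊗ₜ g) - Matrix.scalar (Fin 4) μ := ⟨_, rfl⟩
  rw [← hN] at hlt
  obtain ⟨τ, hτ⟩ : ∃ τ, τ = N.trace := ⟨_, rfl⟩
  have hNN : N * N = τ • N := hτ ▸ Matrix.mul_self_of_rank_le_one (by omega)
  obtain ⟨l₁, hl₁⟩ := exists_algebraMap_eq_trace φ g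
  have hμ : Matrix.scalar (Fin 4) μ = μ • (1 : Matrix (Fin 4) (Fin 4) k) := by
    simp [Matrix.smul_one_eq_diagonal]
  have hA : φ (1 ⊗ₜ g) = N + μ • 1 := by rw [hN, hμ, sub_add_cancel]
  have ht : algebraMap L k l₁ = τ + 4 * μ := by
    rw [hl₁, hA, Matrix.trace_add, ← hτ, Matrix.trace_smul, Matrix.trace_one]
    simp [mul_comm]
  set g' : D := g - algebraMap L D (l₁ / 4) with hg'
  have hψg' : ψ g' = N - (τ / 4) • 1 := by
    rw [hg', map_sub, hscal, hψ, hA, map_div₀, ht, map_ofNat]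
    module
  have hg'0 : g' ≠ 0 := fun h => hg _ (sub_eq_zero.1 h)
  have hsq : ψ (g' * g') = (τ / 2) • N + (τ ^ 2 / 16) • 1 := by
    rw [map_mul, hψg', sub_mul, mul_sub, mul_sub, hNN]
    simp only [smul_mul_assoc, one_mul, mul_smul_comm, mul_one]
    module
  obtain ⟨l₂, hl₂⟩ := exists_algebraMap_eq_trace φ (g' * g')
  have ht2 : algebraMap L k l₂ = 3 * τ ^ 2 / 4 := by
    rw [hl₂, ← hψ, hsq, Matrix.trace_add, Matrix.trace_smul, Matrix.trace_smul, ← hτ,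
      Matrix.trace_one]
    simp
    ring
  have hh : ψ ((g' * g' - algebraMap L D (l₂ / 4)) * g'⁻¹) = (τ / 2) • 1 := by
    have h1 : ψ (g' * g' - algebraMap L D (l₂ / 4)) = (τ / 2) • ψ g' := by
      rw [map_sub, hsq, hscal, hψg', map_div₀, ht2, map_ofNat]
      module
    rw [map_mul, h1, smul_mul_assoc, ← map_mul, mul_inv_cancel₀ hg'0, map_one]
  obtain ⟨l₃, hl₃⟩ := exists_algebraMap_eq_trace φ ((g' * g' - algebraMap L D (l₂ / 4)) * g'⁻¹)
  have ht3 : algebraMap L k l₃ = 2 * τ := by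
    rw [hl₃, ← hψ, hh, Matrix.trace_smul, Matrix.trace_one]
    simp
    ring
  have he : ψ (g' + algebraMap L D (l₃ / 8)) = N := by
    rw [map_add, hscal, hψg', map_div₀, ht3, map_ofNat]
    module
  by_cases h0 : g' + algebraMap L D (l₃ / 8) = 0
  · refine hg (l₁ / 4 - l₃ / 8) ?_
    rw [map_sub, ← sub_eq_zero, ← h0, hg']
    abel
  · have := hψu _ h0
    rw [he] at this
    omega

end

/-! ### Generic points have independent matrix entries -/

/-- Algebraically independent elements are at most as many as the generators of a field that
contains them. -/
theorem AlgebraicIndependent.card_le_of_mem_adjoin {k F ι : Type*} [Field k] [Field F] [Algebra k F]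
    [Fintype ι] {y : ι → F} (hy : AlgebraicIndependent k y) {T : Finset F}
    (h : ∀ i, y i ∈ IntermediateField.adjoin k (T : Set F)) : Fintype.card ι ≤ T.card := by
  have hsub : Set.range y ⊆ (AlgebraicIndependent.matroid k F).closure (T : Set F) := by
    rintro _ ⟨i, rfl⟩
    rw [AlgebraicIndependent.matroid_closure_eq, SetLike.mem_coe, Subalgebra.mem_algebraicClosure]
    open scoped IntermediateField.algebraAdjoinAdjoin in
    exact (Algebra.IsAlgebraic.isAlgebraic (R := Algebra.adjoin k (T : Set F))
      (⟨y i, h i⟩ : IntermediateField.adjoin k (T : Set F))).algebraMap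
  have h1 := (AlgebraicIndependent.matroid k F).eRk_mono hsub
  rw [Matroid.eRk_closure_eq, Matroid.Indep.eRk_eq_encard] at h1
  · have h2 := h1.trans (Matroid.eRk_le_encard _ _)
    rw [← Set.image_univ, hy.injective.encard_image, Set.encard_coe_eq_coe_finsetCard,
      ← Finset.coe_univ, Set.encard_coe_eq_coe_finsetCard] at h2
    exact_mod_cast h2
  · exact AlgebraicIndependent.matroid_indep_iff.2 hy.coe_range

theorem splittingMap_tmul {L k : Type*} [Field L] [Field k] [Algebra L k] {D : Type*} [Ring D]
    [Algebra L D] (φ : k ⊗[L] D ≃ₐ[k] Matrix (Fin 4) (Fin 4) k) (K : Type*) [Field K] [Algebra L K]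
    [Algebra k K] [IsScalarTower L k K] (c : K) (d : D) :
    splittingMap φ K (c ⊗ₜ d) = c • (algebraMap k K).mapMatrix (φ (1 ⊗ₜ d)) :=
  (Algebra.TensorProduct.lift_tmul _ _ _ c d).trans (Algebra.smul_def c _).symm

/-- The matrix entries of an element of `K ⊗ D` determine its coordinates in a basis of `D` by
linear formulas over `k`. -/
theorem formCoords_eq_sum_splittingMap {L k K : Type*} [Field L] [Field k] [Algebra L k] [Field K]
    [Algebra L K] [Algebra k K] [IsScalarTower L k K] {D : Type*} [Ring D] [Algebra L D]
    [FiniteDimensional L D] (φ : k ⊗[L] D ≃ₐ[k] Matrix (Fin 4) (Fin 4) k) (u : K ⊗[L] D)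
    (i : Fin (Module.finrank L D)) :
    formCoords u i = ∑ a, ∑ b, algebraMap k K (((Module.finBasis L D).baseChange k).repr
      (φ.symm (Matrix.single a b 1)) i) * splittingMap φ K u a b := by
  induction u using TensorProduct.induction_on with
  | zero => simp [formCoords]
  | add u v hu hv =>
    simp only [formCoords, map_add, Finsupp.add_apply, Matrix.add_apply, mul_add,
      Finset.sum_add_distrib] at *
    rw [hu, hv]
  | tmul c d =>
    have h1 : ∀ a b, splittingMap φ K (c ⊗ₜ d) a b = c * algebraMap k K (φ (1 ⊗ₜ d) a b) := by
      intro a b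
      rw [splittingMap_tmul]
      rfl
    have h2 : ((Module.finBasis L D).repr d i • (1 : k)) = ∑ a, ∑ b,
        φ (1 ⊗ₜ d) a b * ((Module.finBasis L D).baseChange k).repr
          (φ.symm (Matrix.single a b 1)) i := by
      have h3 : (1 : k) ⊗ₜ[L] d = ∑ a, ∑ b, φ (1 ⊗ₜ d) a b • φ.symm (Matrix.single a b 1) := by
        apply φ.injective
        conv_lhs => rw [Matrix.matrix_eq_sum_single (φ (1 ⊗ₜ d))]
        simp only [map_sum, map_smul, AlgEquiv.apply_symm_apply, Matrix.smul_single, smul_eq_mul,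
          mul_one]
      have h4 := congrArg (fun z => ((Module.finBasis L D).baseChange k).repr z i) h3
      simp only [Module.Basis.baseChange_repr_tmul, map_sum, map_smul, Finsupp.coe_finsetSum,
        Finset.sum_apply, Finsupp.smul_apply, smul_eq_mul] at h4
      exact h4
    have h5 := congrArg (fun z => c * algebraMap k K z) h2
    simp only [map_sum, map_mul, Finset.mul_sum, Algebra.smul_def, mul_one,
      ← IsScalarTower.algebraMap_apply] at h5
    simp only [h1, formCoords, Module.Basis.baseChange_repr_tmul, Algebra.smul_def]
    rw [mul_comm, h5]
    refine Finset.sum_congr rfl fun a _ => Finset.sum_congr rfl fun b _ => by ring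

theorem IsGenericFormPoint.algebraicIndependent {L K : Type*} [Field L] [Field K] [Algebra L K]
    {D : Type*} [Ring D] [Algebra L D] [FiniteDimensional L D] {x : FormPoints L D K}
    (hx : IsGenericFormPoint x) : AlgebraicIndependent L (formCoords (x : K ⊗[L] D)) := by
  have h0 : normForm L D ≠ 0 := by
    intro h
    have := isUnit_aeval_normForm x
    rw [h, map_zero] at this
    exact not_isUnit_zero this
  have hinj : Function.Injective (algebraMap (MvPolynomial (Fin (Module.finrank L D)) L)
      (CoordRing L D)) :=
    IsLocalization.injective _ (powers_le_nonZeroDivisors_of_noZeroDivisors h0)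
  have h : ∀ p, MvPolynomial.aeval (formCoords (x : K ⊗[L] D)) p =
      evalAt x (algebraMap (MvPolynomial (Fin (Module.finrank L D)) L) (CoordRing L D) p) := by
    intro p
    simp [evalAt]
  intro p q hpq
  rw [h, h] at hpq
  exact hinj (hx hpq)

theorem IsGenericFormPoint.hasIndependentEntries {L k K F : Type*} [Field L] [Field k] [Algebra L k]
    [Algebra.IsAlgebraic L k] [Field K] [Algebra L K] [Algebra k K] [IsScalarTower L k K] [Field F]
    [Algebra K F] [Algebra k F] [IsScalarTower k K F] {D : Type*} [Ring D] [Algebra L D]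
    [FiniteDimensional L D] (hD : Module.finrank L D = 16)
    (φ : k ⊗[L] D ≃ₐ[k] Matrix (Fin 4) (Fin 4) k) {x : FormPoints L D K}
    (hx : IsGenericFormPoint x) :
    HasIndependentEntries k ((algebraMap K F).mapMatrix (splittingMap φ K x)) := by
  intro T hT
  have h1 := (hx.algebraicIndependent.extendScalars k).map' (f := IsScalarTower.toAlgHom k K F)
    (algebraMap K F).injective
  have h2 := h1.card_le_of_mem_adjoin (T := T) fun i => by
    rw [Function.comp, formCoords_eq_sum_splittingMap φ, map_sum]
    refine sum_mem fun a _ => ?_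
    rw [map_sum]
    refine sum_mem fun b _ => ?_
    rw [map_mul, AlgHom.commutes]
    exact mul_mem (IntermediateField.algebraMap_mem _ _) (hT a b)
  simpa [hD] using h2

/-! ### Points of the rigid flag variety -/

theorem mem_twistedCubic_mk'' {F : Type*} [Field F] {W : Submodule F (Fin 4 → F)}
    (hW : Module.finrank F W = 1) :
    Projectivization.mk'' W hW ∈ twistedCubic F ↔ ∀ v ∈ W, IsTwistedCubicVector v := by
  simp only [twistedCubic, Set.mem_ofPred_eq, Projectivization.submodule_mk'']
  rfl

theorem IsTwistedCubicVector.map {F E : Type*} [Field F] [Field E] {v : Fin 4 → F}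
    (hv : IsTwistedCubicVector v) (σ : F →+* E) : IsTwistedCubicVector fun i => σ (v i) := by
  obtain ⟨h1, h2, h3⟩ := hv
  refine ⟨?_, ?_, ?_⟩
  · rw [← map_mul, h1, map_pow]
  · rw [← map_mul, h2, map_pow]
  · rw [← map_mul, h3, map_mul]

theorem exists_ne_zero_of_finrank_eq_one {F V : Type*} [Field F] [AddCommGroup V] [Module F V]
    {W : Submodule F V} (hW : Module.finrank F W = 1) : ∃ v ∈ W, v ≠ 0 := by
  refine (Submodule.ne_bot_iff W).1 ?_
  rintro rfl
  simp at hW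

section

variable {K : Type*} [Field K]

/-- The matrix over the algebraic closure that a matrix over `K` defines. -/
noncomputable abbrev overClosure (G : Matrix (Fin 4) (Fin 4) K) :
    Matrix (Fin 4) (Fin 4) (AlgebraicClosure K) :=
  (algebraMap K (AlgebraicClosure K)).mapMatrix G

theorem galois_mulVec (G : Matrix (Fin 4) (Fin 4) K)
    (σ : AlgebraicClosure K ≃ₐ[K] AlgebraicClosure K) (v : Fin 4 → AlgebraicClosure K) :
    (fun i => σ ((overClosure G).mulVec v i)) = (overClosure G).mulVec fun i => σ (v i) := by
  funext i
  simp [Matrix.mulVec, dotProduct, map_sum]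

theorem mem_map_glEquiv (G : GL (Fin 4) K)
    (W : Submodule (AlgebraicClosure K) (Fin 4 → AlgebraicClosure K))
    (w : Fin 4 → AlgebraicClosure K) :
    w ∈ W.map (glEquiv (Matrix.GeneralLinearGroup.map (algebraMap K (AlgebraicClosure K)) G) :
        (Fin 4 → AlgebraicClosure K) →ₗ[AlgebraicClosure K] _) ↔
      ∃ v ∈ W, (overClosure (G : Matrix _ _ K)).mulVec v = w :=
  Submodule.mem_map

/-- Equality of the points `Gf` and `Hf'` of the rigid flag variety, spelled out for the lines and
the hyperplanes. Matrices over `K` commute with the Galois action, so `σ` can be moved to vectors of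
`f`. -/
theorem exists_galois_of_conj {G H : GL (Fin 4) K} {f f' : FullFlag (AlgebraicClosure K)}
    (h : (galoisConj K).r
      (Matrix.GeneralLinearGroup.map (algebraMap K (AlgebraicClosure K)) G • f)
      (Matrix.GeneralLinearGroup.map (algebraMap K (AlgebraicClosure K)) H • f')) :
    ∃ σ : AlgebraicClosure K ≃ₐ[K] AlgebraicClosure K,
      (∀ v ∈ f.line, ∃ v' ∈ f'.line, (overClosure (G : Matrix _ _ K)).mulVec (fun i => σ (v i)) =
        (overClosure (H : Matrix _ _ K)).mulVec v') ∧
      (∀ v' ∈ f'.hyperplane, ∃ v ∈ f.hyperplane,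
        (overClosure (G : Matrix _ _ K)).mulVec (fun i => σ (v i)) =
          (overClosure (H : Matrix _ _ K)).mulVec v') := by
  obtain ⟨σ, h1, -, h3⟩ := h
  refine ⟨σ, fun v hv => ?_, fun v' hv' => ?_⟩
  · have hm := (h1 _).1 ((mem_map_glEquiv G f.line _).2 ⟨v, hv, rfl⟩)
    obtain ⟨v', hv', e⟩ := (mem_map_glEquiv H f'.line _).1 hm
    exact ⟨v', hv', by rw [e, galois_mulVec]⟩
  · obtain ⟨u, hu⟩ : ∃ u, (fun i => σ (u i)) = (overClosure (H : Matrix _ _ K)).mulVec v' :=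
      ⟨fun i => σ.symm ((overClosure (H : Matrix _ _ K)).mulVec v' i),
        funext fun i => σ.apply_symm_apply _⟩
    have hm := (h3 u).2 ((mem_map_glEquiv H f'.hyperplane _).2 ⟨v', hv', hu.symm⟩)
    obtain ⟨v, hv, e⟩ := (mem_map_glEquiv G f.hyperplane _).1 hm
    exact ⟨v, hv, by rw [← hu, ← galois_mulVec, e]⟩

theorem overClosure_inv_mul (H : GL (Fin 4) K) :
    overClosure (H⁻¹ : GL (Fin 4) K).1 * overClosure (H : Matrix _ _ K) = 1 := by
  rw [← map_mul, Units.inv_mul, map_one]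

theorem overClosure_mul_inv (H : GL (Fin 4) K) :
    overClosure (H : Matrix _ _ K) * overClosure (H⁻¹ : GL (Fin 4) K).1 = 1 := by
  rw [← map_mul, Units.mul_inv, map_one]

theorem exists_cubic_vectors_of_smul_eq {G H : GL (Fin 4) K} {P P' : RigidFlagVariety K}
    (hP : P ∈ rigidY K) (hP' : P' ∈ rigidY K) (h : G • P = H • P') :
    ∃ v v' : Fin 4 → AlgebraicClosure K, IsTwistedCubicVector v ∧ v ≠ 0 ∧
      IsTwistedCubicVector v' ∧ v' ≠ 0 ∧
      (overClosure (G : Matrix _ _ K)).mulVec v = (overClosure (H : Matrix _ _ K)).mulVec v' := by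
  obtain ⟨f, hf, rfl⟩ := hP
  obtain ⟨f', hf', rfl⟩ := hP'
  obtain ⟨σ, hσ, -⟩ := exists_galois_of_conj (Quotient.exact h)
  obtain ⟨v, hv, hv0⟩ := exists_ne_zero_of_finrank_eq_one f.finrank_line
  obtain ⟨v', hv', e⟩ := hσ v hv
  have hσv : (fun i => σ (v i)) ≠ 0 := fun h0 => hv0 <| by
    funext i
    simpa using congrFun h0 i
  refine ⟨fun i => σ (v i), v', ((mem_twistedCubic_mk'' _).1 hf v hv).map
      (σ : AlgebraicClosure K →+* AlgebraicClosure K), hσv,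
    (mem_twistedCubic_mk'' _).1 hf' v' hv', ?_, e⟩
  rintro rfl
  rw [Matrix.mulVec_zero] at e
  have := congrArg (overClosure (G⁻¹ : GL (Fin 4) K).1).mulVec e
  rw [Matrix.mulVec_mulVec, overClosure_inv_mul, Matrix.one_mulVec, Matrix.mulVec_zero] at this
  exact hσv this

/-- The group acts on linear forms by inverse transposes. -/
theorem exists_cubic_forms_of_smul_eq {G H : GL (Fin 4) K} {P P' : RigidFlagVariety K}
    (hP : P ∈ rigidYDual K) (hP' : P' ∈ rigidYDual K) (h : G • P = H • P') :
    ∃ a a' : Fin 4 → AlgebraicClosure K, IsTwistedCubicVector a ∧ a ≠ 0 ∧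
      IsTwistedCubicVector a' ∧ a' ≠ 0 ∧
      Matrix.vecMul a (overClosure (G⁻¹ : GL (Fin 4) K).1) =
        Matrix.vecMul a' (overClosure (H⁻¹ : GL (Fin 4) K).1) := by
  obtain ⟨f, hf, rfl⟩ := hP
  obtain ⟨f', hf', rfl⟩ := hP'
  obtain ⟨σ, -, hσ⟩ := exists_galois_of_conj (Quotient.exact h)
  have hdim := finrank_formsVanishingOn f.hyperplane
  rw [f.finrank_hyperplane] at hdim
  obtain ⟨a, ha, ha0⟩ := exists_ne_zero_of_finrank_eq_one
    (W := formsVanishingOn f.hyperplane) (by omega)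
  have hσa : (fun i => σ (a i)) ≠ 0 := fun h0 => ha0 <| by
    funext i
    simpa using congrFun h0 i
  set a' := Matrix.vecMul (Matrix.vecMul (fun i => σ (a i)) (overClosure (G⁻¹ : GL (Fin 4) K).1))
    (overClosure (H : Matrix _ _ K)) with ha'
  have e : Matrix.vecMul (fun i => σ (a i)) (overClosure (G⁻¹ : GL (Fin 4) K).1) =
      Matrix.vecMul a' (overClosure (H⁻¹ : GL (Fin 4) K).1) := by
    rw [ha', Matrix.vecMul_vecMul _ (overClosure (H : Matrix _ _ K)), overClosure_mul_inv,
      Matrix.vecMul_one]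
  refine ⟨fun i => σ (a i), a', ((mem_twistedCubic_mk'' _).1 hf a ha).map
      (σ : AlgebraicClosure K →+* AlgebraicClosure K), hσa,
    (mem_twistedCubic_mk'' _).1 hf' a' ?_, ?_, e⟩
  · intro w hw
    obtain ⟨v, hv, ev⟩ := hσ w hw
    rw [ha', ← Matrix.dotProduct_mulVec, ← ev, ← Matrix.dotProduct_mulVec, Matrix.mulVec_mulVec,
      overClosure_inv_mul, Matrix.one_mulVec]
    have := congrArg σ (ha v hv)
    simpa [dotProduct, map_sum] using this
  · intro h0
    rw [h0, Matrix.zero_vecMul] at e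
    have := congrArg (fun u => Matrix.vecMul u (overClosure (G : Matrix _ _ K))) e
    simp only [Matrix.vecMul_vecMul] at this
    rw [overClosure_inv_mul, Matrix.vecMul_one, Matrix.zero_vecMul] at this
    exact hσa this

theorem smul_eq_self_of_scalar {G : GL (Fin 4) K} {c : K}
    (hG : (G : Matrix (Fin 4) (Fin 4) K) = Matrix.scalar (Fin 4) c) (P : RigidFlagVariety K) :
    G • P = P := by
  have hc : c ≠ 0 := by
    rintro rfl
    exact G.ne_zero (by rw [hG, map_zero])
  induction P using Quotient.inductionOn with
  | h f =>
    have key : ∀ W : Submodule (AlgebraicClosure K) (Fin 4 → AlgebraicClosure K),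
        W.map (glEquiv (Matrix.GeneralLinearGroup.map (algebraMap K (AlgebraicClosure K)) G) :
          (Fin 4 → AlgebraicClosure K) →ₗ[AlgebraicClosure K] _) = W := by
      intro W
      have e : (glEquiv (Matrix.GeneralLinearGroup.map (algebraMap K (AlgebraicClosure K)) G) :
          (Fin 4 → AlgebraicClosure K) →ₗ[AlgebraicClosure K] (Fin 4 → AlgebraicClosure K)) =
          algebraMap K (AlgebraicClosure K) c • LinearMap.id := by
        refine LinearMap.ext fun v => ?_
        change (overClosure (G : Matrix _ _ K)).mulVec v = _
        rw [hG]
        funext i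
        simp [Matrix.scalar_apply, Matrix.diagonal_map, Matrix.mulVec_diagonal, Algebra.smul_def]
      rw [e, Submodule.map_smul _ _ _ ((map_ne_zero _).2 hc), Submodule.map_id]
    exact congrArg (Quotient.mk (galoisConj K)) (FullFlag.ext (key _) (key _) (key _))

end

/-! ### Regularity of the orbits -/

section

variable {L k : Type*} [Field L] [Field k] [Algebra L k] {D : Type*} [Ring D] [Algebra L D]
  (φ : k ⊗[L] D ≃ₐ[k] Matrix (Fin 4) (Fin 4) k) {K : Type*} [Field K] [Algebra L K] [Algebra k K]
  [IsScalarTower L k K]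

/-- The point of `GL₄(K)` that corresponds to a point of `𝔾(K)`. -/
noncomputable abbrev splittingUnit (x : FormPoints L D K) : GL (Fin 4) K :=
  Units.map (splittingMap φ K).toMonoidHom x

theorem rigidAction_apply (x : FormPoints L D K) (P : RigidFlagVariety K) :
    rigidAction φ K x P = splittingUnit φ x • P := rfl

theorem splittingUnit_unitsToFormPoints (g : Dˣ) :
    (splittingUnit φ (unitsToFormPoints L D K g) : Matrix (Fin 4) (Fin 4) K) =
      (algebraMap k K).mapMatrix (φ (1 ⊗ₜ (g : D))) :=
  (splittingMap_tmul φ K 1 (g : D)).trans (one_smul _ _)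

theorem overClosure_splittingUnit (g : Dˣ) :
    overClosure (splittingUnit φ (unitsToFormPoints L D K g) : Matrix (Fin 4) (Fin 4) K) =
      (algebraMap k (AlgebraicClosure K)).mapMatrix (φ (1 ⊗ₜ (g : D))) := by
  rw [splittingUnit_unitsToFormPoints]
  ext i j
  exact (IsScalarTower.algebraMap_apply k K (AlgebraicClosure K) _).symm

/-- Central elements act trivially, since they act by scalar matrices. -/
theorem rigidAction_of_central (g : Dˣ) {l : L} (hg : (g : D) = algebraMap L D l) :
    rigidAction φ K (unitsToFormPoints L D K g) = 1 := by
  refine Equiv.ext fun P => smul_eq_self_of_scalar (c := algebraMap L K l) ?_ P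
  rw [splittingUnit_unitsToFormPoints, hg, ← Algebra.TensorProduct.algebraMap_apply',
    ← AlgEquiv.restrictScalars_apply L, AlgEquiv.commutes]
  ext i j
  simp [Matrix.algebraMap_matrix_apply, Matrix.scalar_apply, Matrix.diagonal_apply,
    IsScalarTower.algebraMap_apply L k K, apply_ite (algebraMap k K)]

/-- Regularity of the orbit of `xY` when noncentral elements have no translates that meet. -/
theorem isRegularOrbit_of_disjoint (x : FormPoints L D K) (Y : Set (RigidFlagVariety K))
    (h : ∀ g : Dˣ, (∀ l : L, (g : D) ≠ algebraMap L D l) → ∀ P ∈ Y, ∀ P' ∈ Y,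
      splittingUnit φ (unitsToFormPoints L D K g * x) • P ≠ splittingUnit φ x • P') :
    IsRegularOrbit ((rigidAction φ K).comp (unitsToFormPoints L D K)) (rigidAction φ K x '' Y) := by
  rintro g ⟨Q, ⟨_, ⟨P, hP, rfl⟩, hQ⟩, P', hP', hQ'⟩
  by_cases hg : ∃ l : L, (g : D) = algebraMap L D l
  · obtain ⟨l, hl⟩ := hg
    rw [MonoidHom.comp_apply, rigidAction_of_central φ g hl, Equiv.Perm.coe_one, Set.image_id]
  · push Not at hg
    refine absurd ?_ (h g hg P hP P' hP')
    rw [← rigidAction_apply, ← rigidAction_apply, map_mul, Equiv.Perm.mul_apply, hQ']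
    exact hQ

end

section

variable {L k K : Type*} [Field L] [CharZero L] [Field k] [Algebra L k] [IsAlgClosure L k] [Field K]
  [Algebra L K] [Algebra k K] [IsScalarTower L k K] {D : Type*} [DivisionRing D] [Algebra L D]
  [FiniteDimensional L D] (hD : Module.finrank L D = 16)
  (φ : k ⊗[L] D ≃ₐ[k] Matrix (Fin 4) (Fin 4) k) {x : FormPoints L D K} (hx : IsGenericFormPoint x)
  {g : Dˣ} (hg : ∀ l : L, (g : D) ≠ algebraMap L D l)

include hD hx hg

theorem smul_ne_smul_of_mem_rigidY {P P' : RigidFlagVariety K} (hP : P ∈ rigidY K)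
    (hP' : P' ∈ rigidY K) :
    splittingUnit φ (unitsToFormPoints L D K g * x) • P ≠ splittingUnit φ x • P' := by
  have := IsAlgClosure.isAlgClosed L (K := k)
  have := IsAlgClosure.isAlgebraic (R := L) (K := k)
  intro h
  obtain ⟨v, v', hv, hv0, hv', hv0', e⟩ := exists_cubic_vectors_of_smul_eq hP hP' h
  have hdet : (φ (1 ⊗ₜ (g : D))).det ≠ 0 :=
    ((Matrix.isUnit_iff_isUnit_det _).1 ((g.isUnit.map
      (Algebra.TensorProduct.includeRight : D →ₐ[L] k ⊗[L] D)).map φ)).ne_zero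
  refine (hx.hasIndependentEntries (F := AlgebraicClosure K) hD φ).mulVec_ne hdet
    (two_le_rank_sub_scalar φ hg) hv hv0 hv' hv0' ?_
  rw [← overClosure_splittingUnit (K := K) φ g]
  refine Eq.trans ?_ e
  rw [splittingUnit, splittingUnit, map_mul, Units.val_mul]
  exact congrArg (fun M : Matrix _ _ _ => M.mulVec v)
    (map_mul (algebraMap K (AlgebraicClosure K)).mapMatrix _ _).symm

/-- The same dimension count as for `rigidY`, applied to the inverse transposes. -/
theorem smul_ne_smul_of_mem_rigidYDual {P P' : RigidFlagVariety K} (hP : P ∈ rigidYDual K)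
    (hP' : P' ∈ rigidYDual K) :
    splittingUnit φ (unitsToFormPoints L D K g * x) • P ≠ splittingUnit φ x • P' := by
  have := IsAlgClosure.isAlgClosed L (K := k)
  have := IsAlgClosure.isAlgebraic (R := L) (K := k)
  intro h
  obtain ⟨a, a', ha, ha0, ha', ha0', e⟩ := exists_cubic_forms_of_smul_eq hP hP' h
  have hg' : ∀ l : L, ((g⁻¹ : Dˣ) : D) ≠ algebraMap L D l := by
    intro l hl
    refine hg l⁻¹ ?_
    rw [map_inv₀, ← hl, Units.val_inv_eq_inv_val, inv_inv]
  have hdet : (φ (1 ⊗ₜ ((g⁻¹ : Dˣ) : D))).transpose.det ≠ 0 := by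
    rw [Matrix.det_transpose]
    exact ((Matrix.isUnit_iff_isUnit_det _).1 (((g⁻¹).isUnit.map
      (Algebra.TensorProduct.includeRight : D →ₐ[L] k ⊗[L] D)).map φ)).ne_zero
  have hrank : ∀ μ : k,
      2 ≤ ((φ (1 ⊗ₜ ((g⁻¹ : Dˣ) : D))).transpose - Matrix.scalar (Fin 4) μ).rank := by
    intro μ
    have h2 := two_le_rank_sub_scalar φ hg' μ
    rwa [← Matrix.rank_transpose, Matrix.transpose_sub, Matrix.scalar_apply,
      Matrix.diagonal_transpose] at h2
  set X := overClosure (splittingUnit φ x : Matrix (Fin 4) (Fin 4) K) with hX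
  have hXinv : overClosure ((splittingUnit φ x)⁻¹ : GL (Fin 4) K).1 = X⁻¹ :=
    (Matrix.inv_eq_left_inv (overClosure_inv_mul _)).symm
  have hXdet : IsUnit X.det :=
    (Matrix.isUnit_iff_isUnit_det _).1 (IsUnit.of_mul_eq_one _ (overClosure_mul_inv _))
  have hZ : HasIndependentEntries k X⁻¹.transpose :=
    ((hx.hasIndependentEntries (F := AlgebraicClosure K) hD φ).inv hXdet).transpose
  refine hZ.mulVec_ne hdet hrank ha ha0 ha' ha0' ?_
  rw [RingHom.mapMatrix_apply, Matrix.transpose_map, ← Matrix.transpose_mul,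
    Matrix.mulVec_transpose, Matrix.mulVec_transpose, ← hXinv, ← e, ← RingHom.mapMatrix_apply,
    ← overClosure_splittingUnit (K := K) φ g⁻¹, ← map_mul, ← Units.val_mul]
  congr 3
  rw [map_inv, splittingUnit, splittingUnit, splittingUnit, map_mul, map_inv, mul_inv_rev]

end

theorem theoremD {p : ℕ} [Fact p.Prime]
    -- `L` is a finite extension of `ℚ_p`
    {L : Type*} [Field L] [Algebra ℚ_[p] L] [FiniteDimensional ℚ_[p] L]
    -- `K` is a complete non-archimedean field extension of `L`
    {K : Type*} [NontriviallyNormedField K] [IsUltrametricDist K] [CompleteSpace K]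
    [NormedAlgebra ℚ_[p] K] [Algebra L K] [IsScalarTower ℚ_[p] L K]
    -- `K` contains an algebraic closure `k` of `L`
    {k : Type*} [Field k] [Algebra L k] [IsAlgClosure L k] [Algebra k K] [IsScalarTower L k K]
    -- `D` is a (central) division algebra of degree `4` over `L`
    {D : Type*} [DivisionRing D] [Algebra L D] [Algebra.IsCentral L D] [FiniteDimensional L D]
    (hD : Module.finrank L D = 16)
    -- `φ` identifies `𝔾` with `GL₄` over `k`
    (φ : k ⊗[L] D ≃ₐ[k] Matrix (Fin 4) (Fin 4) k)
    (x : FormPoints L D K) (hx : IsGenericFormPoint x) :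
    IsRegularOrbit ((rigidAction φ K).comp (unitsToFormPoints L D K))
        (rigidAction φ K x '' rigidY K) ∧
      IsRegularOrbit ((rigidAction φ K).comp (unitsToFormPoints L D K))
        (rigidAction φ K x '' rigidYDual K) := by
  have : CharZero L := charZero_of_injective_algebraMap (algebraMap ℚ_[p] L).injective
  exact ⟨isRegularOrbit_of_disjoint φ x _ fun g hg P hP P' hP' =>
      smul_ne_smul_of_mem_rigidY hD φ hx hg hP hP',
    isRegularOrbit_of_disjoint φ x _ fun g hg P hP P' hP' =>
      smul_ne_smul_of_mem_rigidYDual hD φ hx hg hP hP'⟩
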